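/- A tree-form decision problem is a finite rooted tree in which every path alternates between observation points (also called sequences) $\sigma\in\Sigma$ and decision points $j\in\mathcal J$, the root $\varnothing$ being an observation point; the children of a decision point $j$ are the observation points $ja$, one for each action $a$ in a finite nonempty set $A_j$, and the children of an observation point are (possibly no) decision points. A sequence-form pure strategy is a vector $x\in\{0,1\}^\Sigma$ for which there is a choice of one action at each decision point such that, for every $\sigma$, $x(\sigma)=1$ if every action on the path from $\varnothing$ to $\sigma$ is chosen and $x(\sigma)=0$ otherwise. Let $\mathcal X\subseteq\mathbb R^\Sigma$ be the set of sequence-form pure strategies and $\operatorname{co}\mathcal X$ its convex hull, the sequence-form polytope. Let $\Phi_{\mathrm{Lin}}$ be the set of linear maps $\phi:\mathcal X\to\operatorname{co}\mathcal X$, that is, of functions on $\mathcal X$ with values in $\operatorname{co}\mathcal X$ that are restrictions of linear maps $\mathbb R^\Sigma\to\mathbb R^\Sigma$, regarded as a subset of the real vector space of all functions $\mathcal X\to\mathbb R^\Sigma$. Let $\hat\Phi_{\mathrm{Lin}}=\{\phi\in\Phi_{\mathrm{Lin}}:\phi(x)\in\mathcal X\text{ for all }x\in\mathcal X\}$. **Corollary.**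 For every tree-form decision problem, the set of extreme points of $\Phi_{\mathrm{Lin}}$ is exactly $\hat\Phi_{\mathrm{Lin}}$, and $\Phi_{\mathrm{Lin}}=\operatorname{co}\hat\Phi_{\mathrm{Lin}}$. -/

import Mathlib

universe u v

/-- A tree-form decision problem with decision points `J` and action sets `A j`.
The observation points (sequences) are the root, `none`, and the points `ja = some ⟨j, a⟩` that
follow an action `a` at a decision point `j`; `parent j` is the observation point immediately
preceding `j`. Well-foundedness says that these parent links form a tree rooted at `none`. -/
structure TreeFormDecisionProblem (J : Type u) (A : J → Type v) where
  parent : J → Option (Σ j, A j)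
  wf : WellFounded fun i j : J => ∃ a : A i, parent j = some ⟨i, a⟩

namespace TreeFormDecisionProblem

variable {J : Type u} {A : J → Type v} (T : TreeFormDecisionProblem J A)

/-- The sequences (observation points), the root being `none`. -/
abbrev Seq (_T : TreeFormDecisionProblem J A) : Type (max u v) := Option (Σ j, A j)

/-- The player who plays the action `s j` at every decision point `j` selects every action
on the path from the root to the given sequence. -/
inductive Plays (s : ∀ j, A j) : Option (Σ j, A j) → Prop
  | root : Plays s none
  | step (j : J) : Plays s (T.parent j) → Plays s (some ⟨j, s j⟩)

/-- The sequence-form vector of the choice `s` of one action per decision point: its entry at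
`σ` is `1` if every action on the path to `σ` is selected, and `0` otherwise. -/
noncomputable def sequenceForm (s : ∀ j, A j) : T.Seq → ℝ :=
  Set.indicator {σ | T.Plays s σ} fun _ => 1

/-- The set `X` of sequence-form pure strategies. -/
def pureStrategies : Set (T.Seq → ℝ) := Set.range T.sequenceForm

/-- The set `co X` of sequence-form mixed strategies. -/
def mixedStrategies : Set (T.Seq → ℝ) := convexHull ℝ T.pureStrategies

/-- The linear maps from `X` to `Y`, as functions on `X`: restrictions to `X` of linear maps of
the ambient space that send every point of `X` into `Y`. -/
def linearMapsInto (Y : Set (T.Seq → ℝ)) : Set (T.pureStrategies → T.Seq → ℝ) :=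
  {φ | (∃ L : (T.Seq → ℝ) →ₗ[ℝ] (T.Seq → ℝ), ∀ x, φ x = L x) ∧ ∀ x, φ x ∈ Y}

/-- `Φ_Lin`, the set of linear maps `X → co X`. -/
def PhiLin : Set (T.pureStrategies → T.Seq → ℝ) := T.linearMapsInto T.mixedStrategies

/-- The set of linear maps `X → X`, which send pure strategies to pure strategies. -/
def PhiLinPure : Set (T.pureStrategies → T.Seq → ℝ) := T.linearMapsInto T.pureStrategies

end TreeFormDecisionProblem

/-! The core is that every map in `PhiLin` is a nonnegative flow on an acyclic hypergraph, and such
flows decompose into integral ones. The rows of the matrix of such a map are functionals nonnegative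
on the pure strategies. Adding sequence-form constraints makes their entries nonnegative, with a
zero among the actions of each decision point (`exists_nonneg_coeff`). For each `k`, the constraint
at `k` on the image says that a combination of rows vanishes on the pure strategies, so it is a
combination of constraints with coefficients `l k` (`exists_eq_constraintComb`). The zeros force `l
k ≥ 0`; entries and multipliers together then form a flow (`isHyperflow_iff`). Each hyperedge has a
single source, so a policy minimizes any linear cost and generates an integral flow
(`IsHyperflow.mem_convexHull`). Integral flows are maps into pure strategies, because natural-valued
solutions of the constraints are pure (`mem_pureStrategies_of_nat`). -/

/-! ### Flows on finite directed acyclic hypergraphs -/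

section Flow

open Classical in
/-- Flows on a directed hypergraph with edge set `E`, in which the flow along an edge `e` leaves
the vertex `src e` and is copied to each vertex `t` with `next e t`; `i` is the inflow from
outside. -/
def IsHyperflow {S E : Type*} [Fintype E] (src : E → S) (next : E → S → Prop) (i : S → ℝ)
    (z : E → ℝ) : Prop :=
  (∀ e, 0 ≤ z e) ∧
    ∀ s, (∑ e, if src e = s then z e else 0) = i s + ∑ e, if next e s then z e else 0

theorem WellFounded.flip_of_finite {α : Type*} [Finite α] {r : α → α → Prop}
    (h : WellFounded r) : WellFounded (flip r) := by
  have : IsTrans α (Relation.TransGen (flip r)) := ⟨fun _ _ _ => Relation.TransGen.trans⟩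
  have : Std.Irrefl (Relation.TransGen (flip r)) := ⟨fun a ha => by
    have h2 : Relation.TransGen r a a := Relation.transGen_swap.1 ha
    exact h.transGen.irrefl.irrefl a h2⟩
  exact Subrelation.wf (fun h => Relation.TransGen.single h)
    (Finite.wellFounded_of_trans_of_irrefl (Relation.TransGen (flip r)))

variable {S E : Type*} [Fintype E] {src : E → S} {next : E → S → Prop}

open Classical in
/-- The Bellman equation for the least cost, together with an optimal policy. -/
theorem exists_potential [Fintype S]
    (hwf : WellFounded fun s t => ∃ e, src e = s ∧ next e t) (hsrc : Function.Surjective src) (c : E → ℝ) :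
    ∃ (v : S → ℝ) (p : S → E), (∀ s, src (p s) = s) ∧
      (∀ e, v (src e) ≤ c e + ∑ t, if next e t then v t else 0) ∧
      ∀ s, v s = c (p s) + ∑ t, if next (p s) t then v t else 0 := by
  let G : ∀ s : S, (∀ t, (∃ e, src e = s ∧ next e t) → ℝ) → ℝ := fun s IH =>
    ⨅ e : {e // src e = s}, (c e + ∑ t, if h : next e t then IH t ⟨e, e.2, h⟩ else 0)
  let v : S → ℝ := hwf.flip_of_finite.fix G
  have hv : ∀ s, v s = ⨅ e : {e // src e = s}, (c e + ∑ t, if next e t then v t else 0) := by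
    intro s
    have := hwf.flip_of_finite.fix_eq G s
    simpa only [G, dite_eq_ite] using this
  have hmin : ∀ s, ∃ e : {e // src e = s},
      v s = c e + ∑ t, if next e t then v t else 0 := by
    intro s
    have : Nonempty {e // src e = s} := let ⟨e, he⟩ := hsrc s; ⟨⟨e, he⟩⟩
    obtain ⟨e, he⟩ := exists_eq_ciInf_of_finite
      (f := fun e : {e // src e = s} => c e + ∑ t, if next e t then v t else 0)
    exact ⟨e, by rw [hv s, ← he]⟩
  choose p hp using hmin
  refine ⟨v, fun s => p s, fun s => (p s).2, fun e => ?_, hp⟩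
  rw [hv (src e)]
  exact ciInf_le (Set.finite_range _).bddBelow (⟨e, rfl⟩ : {e' // src e' = src e})

open Classical in
/-- Summation by parts for flows. -/
theorem sum_mul_potential [Fintype S] {i : S → ℝ} {z : E → ℝ}
    (hz : ∀ s, (∑ e, if src e = s then z e else 0) = i s + ∑ e, if next e s then z e else 0)
    (v : S → ℝ) :
    ∑ e, z e * (v (src e) - ∑ t, if next e t then v t else 0) = ∑ s, i s * v s := by
  have h1 : ∑ e, z e * v (src e) = ∑ s, (∑ e, if src e = s then z e else 0) * v s := by
    simp only [Finset.sum_mul]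
    rw [Finset.sum_comm]
    refine Finset.sum_congr rfl fun e _ => ?_
    simp [ite_mul]
  have h2 : ∑ e, z e * (∑ t, if next e t then v t else 0) =
      ∑ s, (∑ e, if next e s then z e else 0) * v s := by
    simp only [Finset.sum_mul, Finset.mul_sum]
    rw [Finset.sum_comm]
    simp [ite_mul]
  simp only [mul_sub, Finset.sum_sub_distrib, h1, h2, hz, add_mul, Finset.sum_add_distrib]
  ring

open Classical in
/-- Each policy generates an integral flow supported on the edges selected by the policy. -/
theorem exists_policy_hyperflow (hwf : WellFounded fun s t => ∃ e, src e = s ∧ next e t)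
    (i : S → ℕ) (p : S → E) (hp : ∀ s, src (p s) = s) :
    ∃ z : E → ℕ, IsHyperflow src next (fun s => (i s : ℝ)) (fun e => (z e : ℝ)) ∧
      ∀ e, p (src e) ≠ e → z e = 0 := by
  let G : ∀ s : S, (∀ t, (∃ e, src e = t ∧ next e s) → ℕ) → ℕ := fun s IH =>
    i s + ∑ e, if h : next e s then (if p (src e) = e then IH (src e) ⟨e, rfl, h⟩ else 0) else 0
  let F : S → ℕ := hwf.fix G
  have hF : ∀ s, F s =
      i s + ∑ e, if next e s then (if p (src e) = e then F (src e) else 0) else 0 := by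
    intro s
    have := hwf.fix_eq G s
    simpa only [G, dite_eq_ite] using this
  refine ⟨fun e => if p (src e) = e then F (src e) else 0, ⟨fun e => by positivity, fun s => ?_⟩,
    fun e he => by simp [he]⟩
  have hs := hF s
  have : (∑ e, if src e = s then (if p (src e) = e then F (src e) else 0) else 0) = F s := by
    rw [Finset.sum_eq_single (p s)]
    · simp [hp]
    · intro e _ he
      split_ifs with h1 h2
      · subst h1; exact absurd h2.symm he
      · rfl
      · rfl
    · simp
  rw [hs] at this
  dsimp only
  exact_mod_cast this

/-- Every flow is a convex combination of integral flows. -/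
theorem IsHyperflow.mem_convexHull [Fintype S]
    (hwf : WellFounded fun s t => ∃ e, src e = s ∧ next e t) (hsrc : Function.Surjective src) {i : S → ℕ} {z : E → ℝ}
    (hz : IsHyperflow src next (fun s => (i s : ℝ)) z) :
    z ∈ convexHull ℝ
      {y | IsHyperflow src next (fun s => (i s : ℝ)) y ∧ ∀ e, ∃ n : ℕ, y e = n} := by
  classical
  choose y hy using fun p : {p : S → E // ∀ s, src (p s) = s} =>
    exists_policy_hyperflow hwf i p.1 p.2
  let R : Set (E → ℝ) := Set.range fun p e => (y p e : ℝ)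
  have hR : R ⊆ {y | IsHyperflow src next (fun s => (i s : ℝ)) y ∧ ∀ e, ∃ n : ℕ, y e = n} := by
    rintro _ ⟨p, rfl⟩
    exact ⟨(hy p).1, fun e => ⟨_, rfl⟩⟩
  refine convexHull_mono hR ?_
  -- A functional separating `z` from the policy flows is a cost: its potential bounds the cost of
  -- `z` below, and the optimal policy's flow attains that bound.
  by_contra hcon
  obtain ⟨f, u, hfz, hfR⟩ := geometric_hahn_banach_point_closed (convex_convexHull ℝ R)
    ((Set.finite_range _).isClosed_convexHull ℝ) hcon
  obtain ⟨v, p, hp, hv, hvp⟩ := exists_potential hwf hsrc (fun e => f (Pi.single e 1))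
  have hf : ∀ w : E → ℝ, f w = ∑ e, w e * f (Pi.single e 1) := by
    intro w
    conv_lhs => rw [← Finset.univ_sum_single w]
    rw [map_sum]
    refine Finset.sum_congr rfl fun e _ => ?_
    rw [← smul_eq_mul, ← map_smul, ← Pi.single_smul, smul_eq_mul, mul_one]
  have hle : ∑ s, (i s : ℝ) * v s ≤ f z := by
    rw [hf, ← sum_mul_potential hz.2 v]
    refine Finset.sum_le_sum fun e _ => mul_le_mul_of_nonneg_left ?_ (hz.1 e)
    linarith [hv e]
  have heq : f (fun e => (y ⟨p, hp⟩ e : ℝ)) = ∑ s, (i s : ℝ) * v s := by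
    rw [hf, ← sum_mul_potential (hy ⟨p, hp⟩).1.2 v]
    refine Finset.sum_congr rfl fun e _ => ?_
    by_cases h : p (src e) = e
    · have := hvp (src e)
      rw [h] at this
      rw [this]; ring
    · simp [(hy ⟨p, hp⟩).2 e h]
  have := hfR _ (subset_convexHull ℝ R ⟨⟨p, hp⟩, rfl⟩)
  linarith

end Flow

/-! ### Linear functionals on the sequence-form polytope -/

namespace TreeFormDecisionProblem

variable {J : Type u} {A : J → Type v} (T : TreeFormDecisionProblem J A)

/-- The value of `l` at the decision point of a sequence, and `0` at the root. -/
def atLast (T : TreeFormDecisionProblem J A) (l : J → ℝ) : T.Seq → ℝ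
  | none => 0
  | some e => l e.1

theorem plays_some_iff {s : ∀ j, A j} {j : J} {a : A j} :
    T.Plays s (some ⟨j, a⟩) ↔ T.Plays s (T.parent j) ∧ a = s j := by
  constructor
  · intro h
    cases h with
    | step _ h => exact ⟨h, rfl⟩
  · rintro ⟨h, rfl⟩
    exact Plays.step j h

open Classical in
theorem sequenceForm_apply (s : ∀ j, A j) (σ : T.Seq) :
    T.sequenceForm s σ = if T.Plays s σ then 1 else 0 := by
  simp [sequenceForm, Set.indicator_apply]

theorem sequenceForm_none (s : ∀ j, A j) : T.sequenceForm s none = 1 := by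
  classical
  rw [sequenceForm_apply, if_pos Plays.root]

theorem sequenceForm_eq_zero_or_one (s : ∀ j, A j) (σ : T.Seq) :
    T.sequenceForm s σ = 0 ∨ T.sequenceForm s σ = 1 := by
  classical
  rw [sequenceForm_apply]
  split_ifs <;> simp

theorem sequenceForm_some_of_ne {s : ∀ j, A j} {j : J} {a : A j} (h : a ≠ s j) :
    T.sequenceForm s (some ⟨j, a⟩) = 0 := by
  classical
  rw [sequenceForm_apply, if_neg]
  rw [plays_some_iff]
  exact fun h' => h h'.2

theorem sum_sequenceForm [∀ j, Fintype (A j)] (s : ∀ j, A j) (j : J) :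
    ∑ a, T.sequenceForm s (some ⟨j, a⟩) = T.sequenceForm s (T.parent j) := by
  classical
  rw [Finset.sum_eq_single (s j)]
  · simp [sequenceForm_apply, plays_some_iff]
  · exact fun a _ ha => T.sequenceForm_some_of_ne ha
  · simp

theorem mixedStrategies_subset [∀ j, Fintype (A j)] :
    T.mixedStrategies ⊆ {y | (∀ σ, 0 ≤ y σ ∧ y σ ≤ 1) ∧ y none = 1 ∧
      ∀ j, ∑ a, y (some ⟨j, a⟩) = y (T.parent j)} := by
  refine convexHull_min ?_ ?_
  · rintro _ ⟨s, rfl⟩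
    refine ⟨fun σ => ?_, T.sequenceForm_none s, T.sum_sequenceForm s⟩
    rcases T.sequenceForm_eq_zero_or_one s σ with h | h <;> simp [h]
  · rintro y ⟨hy1, hy2, hy3⟩ w ⟨hw1, hw2, hw3⟩ a b ha hb hab
    refine ⟨fun σ => ⟨?_, ?_⟩, ?_, fun j => ?_⟩
    · have := (hy1 σ).1
      have := (hw1 σ).1
      simp only [Pi.add_apply, Pi.smul_apply, smul_eq_mul]
      positivity
    · simp only [Pi.add_apply, Pi.smul_apply, smul_eq_mul]
      nlinarith [mul_le_mul_of_nonneg_left (hy1 σ).2 ha, mul_le_mul_of_nonneg_left (hw1 σ).2 hb]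
    · simp [hy2, hw2, hab]
    · simp only [Pi.add_apply, Pi.smul_apply, smul_eq_mul, Finset.sum_add_distrib,
        ← Finset.mul_sum, hy3, hw3]

/-- Integral solutions of the sequence-form constraints are pure strategies. -/
theorem mem_pureStrategies_of_nat [∀ j, Fintype (A j)] [∀ j, Nonempty (A j)] {y : T.Seq → ℕ}
    (h0 : y none = 1) (hy : ∀ j, ∑ a, y (some ⟨j, a⟩) = y (T.parent j)) :
    (fun σ => (y σ : ℝ)) ∈ T.pureStrategies := by
  classical
  -- Pick an action of nonzero weight; at unreached decision points the choice is immaterial.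
  have hex : ∀ j, ∃ b : A j, (∃ a : A j, y (some ⟨j, a⟩) ≠ 0) → y (some ⟨j, b⟩) ≠ 0 := by
    intro j
    by_cases h : ∃ a : A j, y (some ⟨j, a⟩) ≠ 0
    · obtain ⟨b, hb⟩ := h
      exact ⟨b, fun _ => hb⟩
    · exact ⟨Classical.arbitrary _, fun h' => absurd h' h⟩
  choose s hs using hex
  refine ⟨s, ?_⟩
  have key : ∀ j (a : A j), y (some ⟨j, a⟩) = if T.Plays s (some ⟨j, a⟩) then 1 else 0 := by
    intro j
    induction j using T.wf.induction with
    | _ j IH =>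
    intro a
    have hpar : y (T.parent j) = if T.Plays s (T.parent j) then 1 else 0 := by
      rcases hj : T.parent j with _ | ⟨i, b⟩
      · rw [h0, if_pos Plays.root]
      · exact IH i ⟨b, hj⟩ b
    have hsum := hy j
    rw [hpar] at hsum
    by_cases hP : T.Plays s (T.parent j)
    · rw [if_pos hP] at hsum
      have hsj : y (some ⟨j, s j⟩) ≠ 0 := by
        refine hs j ?_
        by_contra! hall
        simp [hall] at hsum
      rw [← Finset.add_sum_erase _ _ (Finset.mem_univ (s j))] at hsum
      by_cases ha : a = s j
      · subst ha
        rw [if_pos (Plays.step j hP)]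
        omega
      · rw [if_neg (by rw [plays_some_iff]; exact fun h => ha h.2)]
        have := Finset.single_le_sum (f := fun a => y (some ⟨j, a⟩)) (fun _ _ => Nat.zero_le _)
          (Finset.mem_erase.2 ⟨ha, Finset.mem_univ a⟩)
        omega
    · rw [if_neg hP, Finset.sum_eq_zero_iff] at hsum
      rw [hsum a (Finset.mem_univ a), if_neg]
      rw [plays_some_iff]
      exact fun h => hP h.1
  funext σ
  rw [sequenceForm_apply]
  rcases σ with _ | ⟨j, a⟩
  · simp [Plays.root, h0]
  · rw [key j a]
    simp

/-- Every sequence is played by some pure strategy. -/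
theorem exists_plays [∀ j, Nonempty (A j)] (σ : T.Seq) : ∃ s, T.Plays s σ := by
  classical
  -- Changing the action at `j` does not affect sequences whose last decision point is a strict
  -- ancestor of `j`.
  have upd : ∀ (s : ∀ j, A j) (τ : T.Seq), T.Plays s τ → ∀ (j : J) (a : A j),
      (∀ i b, τ = some ⟨i, b⟩ → Relation.TransGen (fun i j => ∃ a, T.parent j = some ⟨i, a⟩) i j) →
      T.Plays (Function.update s j a) τ := by
    intro s τ h
    induction h with
    | root => exact fun _ _ _ => Plays.root
    | step k _ IH =>
      intro j a hr
      have hk := hr k _ rfl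
      rw [plays_some_iff]
      refine ⟨IH j a fun i b hb => Relation.TransGen.head ⟨b, hb⟩ hk, ?_⟩
      rw [Function.update_of_ne]
      rintro rfl
      exact T.wf.transGen.irrefl.irrefl _ hk
  have key : ∀ j (a : A j), ∃ s, T.Plays s (some ⟨j, a⟩) := by
    intro j
    induction j using T.wf.induction with
    | _ j IH =>
    intro a
    have : ∃ s, T.Plays s (T.parent j) := by
      rcases hj : T.parent j with _ | ⟨i, b⟩
      · exact ⟨fun _ => Classical.arbitrary _, Plays.root⟩
      · exact IH i ⟨b, hj⟩ b
    obtain ⟨s, hs⟩ := this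
    refine ⟨Function.update s j a, T.plays_some_iff.2 ⟨upd s _ hs j a fun i b hb =>
      Relation.TransGen.single ⟨b, hb⟩, by simp⟩⟩
  rcases σ with _ | ⟨j, a⟩
  · exact ⟨fun _ => Classical.arbitrary _, Plays.root⟩
  · exact key j a

variable [Fintype J]

open Classical in
/-- The combination of the sequence-form constraints with coefficients `l`: its entry at `σ` is
the sum of `l` over the children of `σ` minus the value of `l` at the parent of `σ`. -/
noncomputable def constraintComb (l : J → ℝ) (σ : T.Seq) : ℝ :=
  (∑ t, if T.parent t = σ then l t else 0) - T.atLast l σ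

theorem constraintComb_neg (l : J → ℝ) (σ : T.Seq) :
    T.constraintComb (-l) σ = - T.constraintComb l σ := by
  rcases σ with _ | e <;>
  simp [constraintComb, atLast, ← Finset.sum_neg_distrib, neg_ite, add_comm, sub_eq_add_neg]

variable [∀ j, Fintype (A j)]

theorem sum_constraintComb_mul {y : T.Seq → ℝ}
    (hy : ∀ j, ∑ a, y (some ⟨j, a⟩) = y (T.parent j)) (l : J → ℝ) :
    ∑ σ, T.constraintComb l σ * y σ = 0 := by
  classical
  have h1 : ∑ σ : T.Seq, (∑ t, if T.parent t = σ then l t else 0) * y σ =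
      ∑ t, l t * y (T.parent t) := by
    simp only [Finset.sum_mul]
    rw [Finset.sum_comm]
    simp [ite_mul]
  have h2 : ∑ σ : T.Seq, T.atLast l σ * y σ = ∑ t, l t * y (T.parent t) := by
    rw [Fintype.sum_option]
    simp only [atLast, zero_mul, zero_add, Fintype.sum_sigma, ← Finset.mul_sum, hy]
  simp only [constraintComb, sub_mul, Finset.sum_sub_distrib, h1, h2, sub_self]

/-- Backward induction: `l j` is the least cost obtainable from `j` on and `s` an optimal strategy.
The shifted coefficients are reduced costs, and the root entry is the minimum of `c`. -/
theorem exists_normalization [∀ j, Nonempty (A j)] (c : T.Seq → ℝ) :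
    ∃ (l : J → ℝ) (s : ∀ j, A j),
      (∀ e, 0 ≤ c (some e) + T.constraintComb l (some e)) ∧
      (∀ j, c (some ⟨j, s j⟩) + T.constraintComb l (some ⟨j, s j⟩) = 0) ∧
      c none + T.constraintComb l none = ∑ σ, c σ * T.sequenceForm s σ := by
  classical
  obtain ⟨l, p, hp, hl, hlp⟩ := exists_potential (src := fun e : Σ j, A j => e.1)
    (next := fun e t => T.parent t = some e)
    (Subrelation.wf (by rintro i j ⟨⟨_, a⟩, rfl, h⟩; exact ⟨a, h⟩) T.wf)
    (fun j => ⟨⟨j, Classical.arbitrary _⟩, rfl⟩) (fun e => c (some e))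
  have hp' : ∀ j, ∃ a, p j = ⟨j, a⟩ := by
    intro j
    rcases hpj : p j with ⟨i, a⟩
    have := hp j
    rw [hpj] at this
    subst this
    exact ⟨a, rfl⟩
  choose s hs using hp'
  have hzero : ∀ j, c (some ⟨j, s j⟩) + T.constraintComb l (some ⟨j, s j⟩) = 0 := by
    intro j
    have : l j = c (some ⟨j, s j⟩) + ∑ t, if T.parent t = some ⟨j, s j⟩ then l t else 0 := by
      have h := hlp j
      rw [hs j] at h
      convert h
    simp only [constraintComb, atLast]
    linarith
  refine ⟨l, s, fun e => ?_, hzero, ?_⟩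
  · have : l e.1 ≤ c (some e) + ∑ t, if T.parent t = some e then l t else 0 := by
      convert hl e
    simp only [constraintComb, atLast]
    linarith
  · have h := T.sum_constraintComb_mul (T.sum_sequenceForm s) l
    have h2 : ∑ σ, (c σ + T.constraintComb l σ) * T.sequenceForm s σ =
        c none + T.constraintComb l none := by
      rw [Finset.sum_eq_single none]
      · rw [sequenceForm_none, mul_one]
      · rintro (_ | ⟨j, a⟩) _ hσ
        · exact absurd rfl hσ
        · by_cases ha : a = s j
          · subst ha
            rw [hzero, zero_mul]
          · rw [T.sequenceForm_some_of_ne ha, mul_zero]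
      · simp
    rw [← h2]
    simp only [add_mul, Finset.sum_add_distrib, h, add_zero]

/-- A linear functional that is nonnegative on the pure strategies has nonnegative coefficients
which vanish for some action at each decision point. -/
theorem exists_nonneg_coeff [∀ j, Nonempty (A j)] {c : T.Seq → ℝ}
    (hc : ∀ s, 0 ≤ ∑ σ, c σ * T.sequenceForm s σ) :
    ∃ m : T.Seq → ℝ, (∀ σ, 0 ≤ m σ) ∧ (∀ j, ∃ a, m (some ⟨j, a⟩) = 0) ∧
      ∀ s, ∑ σ, m σ * T.sequenceForm s σ = ∑ σ, c σ * T.sequenceForm s σ := by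
  obtain ⟨l, s, h1, h2, h3⟩ := T.exists_normalization c
  refine ⟨fun σ => c σ + T.constraintComb l σ, ?_, fun j => ⟨s j, h2 j⟩, fun s' => ?_⟩
  · rintro (_ | e)
    · simpa only [h3] using hc s
    · exact h1 e
  · simp only [add_mul, Finset.sum_add_distrib, T.sum_constraintComb_mul (T.sum_sequenceForm s') l,
      add_zero]

/-- A linear functional that vanishes on the pure strategies is a combination of the
sequence-form constraints. -/
theorem exists_eq_constraintComb [∀ j, Nonempty (A j)] {c : T.Seq → ℝ}
    (hc : ∀ s, ∑ σ, c σ * T.sequenceForm s σ = 0) : ∃ l, ∀ σ, c σ = T.constraintComb l σ := by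
  classical
  obtain ⟨l, s, h1, -, h3⟩ := T.exists_normalization c
  refine ⟨-l, fun σ => ?_⟩
  rw [constraintComb_neg, eq_neg_iff_add_eq_zero]
  have hnn : ∀ σ, 0 ≤ c σ + T.constraintComb l σ := by
    rintro (_ | e)
    · rw [h3, hc]
    · exact h1 e
  -- A vanishing sum of nonnegative terms has zero terms, and `s'` gives the entry at `σ` weight
  -- one.
  obtain ⟨s', hs'⟩ := T.exists_plays σ
  have hsum : ∑ σ, (c σ + T.constraintComb l σ) * T.sequenceForm s' σ = 0 := by
    simp only [add_mul, Finset.sum_add_distrib, hc,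
      T.sum_constraintComb_mul (T.sum_sequenceForm s') l, add_zero]
  rw [Finset.sum_eq_zero_iff_of_nonneg] at hsum
  · simpa [sequenceForm_apply, hs'] using hsum σ (Finset.mem_univ σ)
  · intro τ _
    refine mul_nonneg (hnn τ) ?_
    rw [sequenceForm_apply]
    split_ifs <;> simp

end TreeFormDecisionProblem

/-! ### Linear maps between pure strategies as flows -/

namespace TreeFormDecisionProblem

variable {J : Type u} {A : J → Type v} (T : TreeFormDecisionProblem J A)

/-- The edges of the hypergraph that represents linear maps. Its vertices are the pairs `(σ, k)`
of a sequence and a decision point. The edge `inl (j, k)` leaves `(parent j, k)` and ends at all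
vertices `(ja, k)`; the edge `inr (ka, σ)` leaves `(σ, k)` and ends at the vertices `(σ, l)` with
`parent l = ka`. -/
abbrev MapEdge (T : TreeFormDecisionProblem J A) : Type (max u v) :=
  (J × J) ⊕ ((Σ j, A j) × T.Seq)

/-- The vertex which an edge leaves. -/
def mapSrc : T.MapEdge → T.Seq × J
  | Sum.inl (j, k) => (T.parent j, k)
  | Sum.inr (e, σ) => (σ, e.1)

/-- The incidence of an edge with the vertices at which it ends. -/
def MapNext : T.MapEdge → T.Seq × J → Prop
  | Sum.inl (j, k), (σ, l) => (∃ a, σ = some ⟨j, a⟩) ∧ l = k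
  | Sum.inr (e, τ), (σ, l) => σ = τ ∧ T.parent l = some e

open Classical in
/-- The external inflow. -/
noncomputable def mapSource (s : T.Seq × J) : ℕ := if s.1 = none ∧ T.parent s.2 = none then 1 else 0

theorem wellFounded_seq :
    WellFounded fun σ τ : T.Seq => ∃ j a, τ = some ⟨j, a⟩ ∧ T.parent j = σ := by
  have hnone : Acc (fun σ τ : T.Seq => ∃ j a, τ = some ⟨j, a⟩ ∧ T.parent j = σ) none :=
    ⟨_, by rintro _ ⟨j, a, h, -⟩; cases h⟩
  have hsome : ∀ j (a : A j),
      Acc (fun σ τ : T.Seq => ∃ j a, τ = some ⟨j, a⟩ ∧ T.parent j = σ) (some ⟨j, a⟩) := by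
    intro j
    induction j using T.wf.induction with
    | _ j IH =>
    intro a
    refine ⟨_, ?_⟩
    rintro σ ⟨j', a', h, h'⟩
    cases h
    rcases σ with _ | ⟨i, b⟩
    · exact hnone
    · exact IH i ⟨b, h'⟩ b
  refine ⟨?_⟩
  rintro (_ | ⟨j, a⟩)
  · exact hnone
  · exact hsome j a

theorem wellFounded_map : WellFounded fun s t => ∃ e, T.mapSrc e = s ∧ T.MapNext e t := by
  -- Each edge moves exactly one coordinate a step down the tree.
  refine Subrelation.wf ?_ (WellFounded.prod_gameAdd T.wellFounded_seq T.wf)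
  rintro _ ⟨σ, l⟩ ⟨⟨j, k⟩ | ⟨⟨k, a⟩, τ⟩, rfl, h⟩
  · obtain ⟨⟨a, rfl⟩, rfl⟩ := h
    exact Prod.GameAdd.fst ⟨j, a, rfl, rfl⟩
  · obtain ⟨rfl, h⟩ := h
    exact Prod.GameAdd.snd ⟨a, h⟩

theorem mapSrc_surjective [∀ j, Nonempty (A j)] : Function.Surjective T.mapSrc := fun s =>
  ⟨Sum.inr (⟨s.2, Classical.arbitrary _⟩, s.1), rfl⟩

open Classical in
/-- The coefficients of the map represented by `z`. -/
noncomputable def row (z : T.MapEdge → ℝ) : T.Seq → T.Seq → ℝ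
  | none, σ => if σ = none then 1 else 0
  | some e, σ => z (Sum.inr (e, σ))

/-! ### Convexity and extreme points of `PhiLin` -/

theorem convex_PhiLin : Convex ℝ T.PhiLin := by
  rintro f ⟨⟨L, hL⟩, hf⟩ g ⟨⟨M, hM⟩, hg⟩ a b ha hb hab
  refine ⟨⟨a • L + b • M, fun x => ?_⟩, fun x => ?_⟩
  · simp [hL, hM]
  · exact convex_convexHull ℝ _ (hf x) (hg x) ha hb hab

theorem PhiLinPure_subset_PhiLin : T.PhiLinPure ⊆ T.PhiLin := fun _ hf =>
  ⟨hf.1, fun x => subset_convexHull ℝ _ (hf.2 x)⟩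

/-- Coordinates of mixed strategies lie in `[0, 1]`, and those of pure strategies are endpoints of
that interval. -/
theorem PhiLinPure_subset_extremePoints [∀ j, Fintype (A j)] :
    T.PhiLinPure ⊆ Set.extremePoints ℝ T.PhiLin := by
  intro f hf
  refine ⟨T.PhiLinPure_subset_PhiLin hf, ?_⟩
  rintro g hg h hh ⟨a, b, ha, hb, hab, hgh⟩
  ext x σ
  have hg' := (T.mixedStrategies_subset (hg.2 x)).1 σ
  have hh' := (T.mixedStrategies_subset (hh.2 x)).1 σ
  have heq : a * g x σ + b * h x σ = f x σ := by rw [← hgh]; rfl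
  obtain ⟨s, hs⟩ := hf.2 x
  rcases hs ▸ T.sequenceForm_eq_zero_or_one s σ with h0 | h1
  · rw [h0] at heq ⊢
    nlinarith [mul_nonneg hb.le hh'.1]
  · rw [h1] at heq ⊢
    nlinarith [mul_le_mul_of_nonneg_left hh'.2 hb.le]

/-! ### Correspondence between flows and linear maps -/

variable [Fintype J] [∀ j, Fintype (A j)]

/-- Flow conservation says that the rows satisfy the sequence-form constraints modulo
combinations of the sequence-form constraints. -/
theorem isHyperflow_iff (z : T.MapEdge → ℝ) :
    IsHyperflow T.mapSrc T.MapNext (fun s => (T.mapSource s : ℝ)) z ↔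
      (∀ e, 0 ≤ z e) ∧ ∀ σ k, T.row z (T.parent k) σ - ∑ a, T.row z (some ⟨k, a⟩) σ =
        T.constraintComb (fun j => z (Sum.inl (j, k))) σ := by
  classical
  refine and_congr_right fun _ => ?_
  rw [Prod.forall]
  refine forall_congr' fun σ => forall_congr' fun k => ?_
  have hout : (∑ e, if T.mapSrc e = (σ, k) then z e else 0) =
      (∑ j, if T.parent j = σ then z (Sum.inl (j, k)) else 0) +
        ∑ a, T.row z (some ⟨k, a⟩) σ := by
    rw [Fintype.sum_sum_type, Fintype.sum_prod_type, Fintype.sum_prod_type, Fintype.sum_sigma]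
    congr 1
    · refine Finset.sum_congr rfl fun j _ => ?_
      simp [mapSrc, Prod.ext_iff, ite_and]
    · rw [Finset.sum_eq_single k]
      · simp [mapSrc, Prod.ext_iff, row]
      · intro j _ hj
        simp [mapSrc, Prod.ext_iff, hj]
      · simp
  -- The external inflow is exactly the fixed root row, which no edge carries.
  have hin : (∑ e, if T.MapNext e (σ, k) then z e else 0) + T.mapSource (σ, k) =
      T.atLast (fun j => z (Sum.inl (j, k))) σ + T.row z (T.parent k) σ := by
    rw [Fintype.sum_sum_type, Fintype.sum_prod_type, Fintype.sum_prod_type, add_assoc]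
    congr 1
    · rcases σ with _ | ⟨j, a⟩
      · simp [MapNext, atLast]
      · simp only [atLast]
        rw [Finset.sum_eq_single j]
        · simp [MapNext]
        · intro i _ hi
          refine Finset.sum_eq_zero fun l _ => if_neg ?_
          rintro ⟨⟨b, hb⟩, -⟩
          cases hb
          exact hi rfl
        · simp
    · rcases hk : T.parent k with _ | e
      · simp [MapNext, mapSource, row, hk]
      · simp [MapNext, mapSource, row, hk, ite_and]
  have key : ((∑ e, if T.mapSrc e = (σ, k) then z e else 0) =
      T.mapSource (σ, k) + ∑ e, if T.MapNext e (σ, k) then z e else 0) ↔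
      T.row z (T.parent k) σ - ∑ a, T.row z (some ⟨k, a⟩) σ =
        T.constraintComb (fun j => z (Sum.inl (j, k))) σ := by
    rw [hout, constraintComb]
    constructor <;> intro h <;> linarith
  convert key

/-- The map represented by `z`. -/
noncomputable def flowMap (z : T.MapEdge → ℝ) (x : T.pureStrategies) (τ : T.Seq) : ℝ :=
  ∑ σ, T.row z τ σ * x.1 σ

theorem flowMap_mem_PhiLinPure [∀ j, Nonempty (A j)] {z : T.MapEdge → ℝ}
    (hz : IsHyperflow T.mapSrc T.MapNext (fun s => (T.mapSource s : ℝ)) z)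
    (hn : ∀ e, ∃ n : ℕ, z e = n) : T.flowMap z ∈ T.PhiLinPure := by
  classical
  refine ⟨⟨LinearMap.pi fun τ => ∑ σ, T.row z τ σ • LinearMap.proj σ, fun x => ?_⟩, ?_⟩
  · ext τ
    simp [flowMap]
  rintro ⟨x, s, rfl⟩
  obtain ⟨-, hz⟩ := (T.isHyperflow_iff z).1 hz
  have hrow : ∀ τ σ, ∃ n : ℕ, T.row z τ σ = n := by
    rintro (_ | e) σ
    · exact ⟨if σ = none then 1 else 0, by simp [row]⟩
    · exact hn _
  choose r hr using hrow
  let y : T.Seq → ℕ := fun τ => ∑ σ, r τ σ * if T.Plays s σ then 1 else 0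
  have hy : T.flowMap z ⟨T.sequenceForm s, s, rfl⟩ = fun τ => (y τ : ℝ) := by
    ext τ
    simp only [flowMap, hr, y, sequenceForm_apply]
    push_cast
    rfl
  rw [hy]
  refine T.mem_pureStrategies_of_nat ?_ fun k => ?_
  · have := congrFun hy none
    simp only [flowMap, row, ite_mul, one_mul, zero_mul, Finset.sum_ite_eq', Finset.mem_univ,
      if_true, sequenceForm_none] at this
    exact_mod_cast this.symm
  · have h := T.sum_constraintComb_mul (T.sum_sequenceForm s) (fun j => z (Sum.inl (j, k)))
    simp only [← hz, sub_mul, Finset.sum_sub_distrib, Finset.sum_mul] at h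
    rw [Finset.sum_comm] at h
    have hy' : ∀ τ, ∑ σ, T.row z τ σ * T.sequenceForm s σ = (y τ : ℝ) := fun τ => congrFun hy τ
    simp only [hy'] at h
    have : (∑ a, (y (some ⟨k, a⟩) : ℝ)) = y (T.parent k) := by linarith
    exact_mod_cast this

theorem flowMap_mem_convexHull [∀ j, Nonempty (A j)] {z : T.MapEdge → ℝ}
    (hz : IsHyperflow T.mapSrc T.MapNext (fun s => (T.mapSource s : ℝ)) z) :
    T.flowMap z ∈ convexHull ℝ T.PhiLinPure := by
  classical
  have hmem := hz.mem_convexHull T.wellFounded_map T.mapSrc_surjective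
  -- The fixed root row makes `row` affine rather than linear, hence `a + b = 1`.
  have hrow : ∀ z w : T.MapEdge → ℝ, ∀ a b : ℝ, a + b = 1 → ∀ τ σ,
      T.row (a • z + b • w) τ σ = a * T.row z τ σ + b * T.row w τ σ := by
    rintro z w a b hab (_ | e) σ
    · by_cases h : σ = none <;> simp [row, h, hab]
    · simp [row]
  have hconv : Convex ℝ (T.flowMap ⁻¹' convexHull ℝ T.PhiLinPure) := by
    intro z hz w hw a b ha hb hab
    have := convex_convexHull ℝ T.PhiLinPure hz hw ha hb hab
    have heq : T.flowMap (a • z + b • w) = a • T.flowMap z + b • T.flowMap w := by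
      ext x τ
      simp only [flowMap, hrow z w a b hab, Pi.add_apply, Pi.smul_apply, smul_eq_mul,
        Finset.mul_sum, ← Finset.sum_add_distrib]
      refine Finset.sum_congr rfl fun σ _ => by ring
    rwa [Set.mem_preimage, heq]
  refine convexHull_min (fun w hw => ?_) hconv hmem
  exact subset_convexHull ℝ T.PhiLinPure (T.flowMap_mem_PhiLinPure hw.1 hw.2)

theorem exists_hyperflow_of_mem_PhiLin [∀ j, Nonempty (A j)] {f : T.pureStrategies → T.Seq → ℝ}
    (hf : f ∈ T.PhiLin) :
    ∃ z, IsHyperflow T.mapSrc T.MapNext (fun s => (T.mapSource s : ℝ)) z ∧ T.flowMap z = f := by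
  classical
  obtain ⟨⟨L, hL⟩, hmix⟩ := hf
  let X : (∀ j, A j) → T.pureStrategies := fun s => ⟨T.sequenceForm s, s, rfl⟩
  have hfX : ∀ s, f (X s) ∈ _ := fun s => T.mixedStrategies_subset (hmix (X s))
  have hcoef : ∀ s τ, ∑ σ, L (Pi.single σ 1) τ * T.sequenceForm s σ = f (X s) τ := by
    intro s τ
    rw [hL]
    change _ = L (T.sequenceForm s) τ
    conv_rhs => rw [← Finset.univ_sum_single (T.sequenceForm s)]
    rw [map_sum, Finset.sum_apply]
    refine Finset.sum_congr rfl fun σ _ => ?_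
    rw [mul_comm, ← smul_eq_mul, ← Pi.smul_apply, ← map_smul, ← Pi.single_smul, smul_eq_mul,
      mul_one]
  have hm : ∀ e : Σ j, A j, ∃ m : T.Seq → ℝ, (∀ σ, 0 ≤ m σ) ∧
      (∀ j, ∃ a, m (some ⟨j, a⟩) = 0) ∧
      ∀ s, ∑ σ, m σ * T.sequenceForm s σ = f (X s) (some e) := by
    intro e
    obtain ⟨m, h1, h2, h3⟩ := T.exists_nonneg_coeff
      (c := fun σ => L (Pi.single σ 1) (some e)) (fun s => by
        rw [hcoef]; exact ((hfX s).1 _).1)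
    exact ⟨m, h1, h2, fun s => by rw [h3, hcoef]⟩
  choose m hm0 hm1 hm2 using hm
  have hrowsum : ∀ l : J × J → ℝ, ∀ s τ,
      ∑ σ, T.row (Sum.elim l fun p => m p.1 p.2) τ σ * T.sequenceForm s σ = f (X s) τ := by
    rintro l s (_ | e)
    · simp [row, sequenceForm_none, (hfX s).2.1]
    · exact hm2 e s
  have hl : ∀ k, ∃ l : J → ℝ, ∀ σ, T.row (Sum.elim 0 fun p => m p.1 p.2) (T.parent k) σ -
      ∑ a, T.row (Sum.elim 0 fun p => m p.1 p.2) (some ⟨k, a⟩) σ = T.constraintComb l σ := by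
    intro k
    refine T.exists_eq_constraintComb fun s => ?_
    simp only [sub_mul, Finset.sum_sub_distrib, Finset.sum_mul]
    rw [Finset.sum_comm]
    simp only [hrowsum, (hfX s).2.2, sub_self]
  choose l hl using hl
  have hrow0 : ∀ τ j, ∃ a, T.row (Sum.elim 0 fun p => m p.1 p.2) τ (some ⟨j, a⟩) = 0 := by
    rintro (_ | e) j
    · exact ⟨Classical.arbitrary _, by simp [row]⟩
    · exact hm1 e j
  -- Induction from the leaves up: at an action where the row of `parent k` vanishes, `l k j` is a
  -- sum of nonnegative row entries and of the multipliers at the children.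
  have hlnn : ∀ k j, 0 ≤ l k j := by
    intro k j
    induction j using T.wf.flip_of_finite.induction with
    | _ j IH =>
    obtain ⟨a, ha⟩ := hrow0 (T.parent k) j
    have h := hl k (some ⟨j, a⟩)
    rw [ha, constraintComb] at h
    have h1 : 0 ≤ ∑ t, if T.parent t = some ⟨j, a⟩ then l k t else 0 := by
      refine Finset.sum_nonneg fun t _ => ?_
      split_ifs with ht
      · exact IH t ⟨a, ht⟩
      · exact le_rfl
    have h2 : 0 ≤ ∑ b, T.row (Sum.elim 0 fun p => m p.1 p.2) (some ⟨k, b⟩) (some ⟨j, a⟩) :=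
      Finset.sum_nonneg fun b _ => hm0 _ _
    simp only [atLast] at h
    linarith
  have hroweq : ∀ l : J × J → ℝ, T.row (Sum.elim l fun p => m p.1 p.2) =
      T.row (Sum.elim 0 fun p => m p.1 p.2) := by
    intro l
    ext (_ | e) σ <;> rfl
  refine ⟨Sum.elim (fun p => l p.2 p.1) fun p => m p.1 p.2, (T.isHyperflow_iff _).2 ⟨?_, ?_⟩, ?_⟩
  · rintro (p | p)
    · exact hlnn _ _
    · exact hm0 _ _
  · intro σ k
    rw [hroweq]
    exact hl k σ
  · ext ⟨x, s, rfl⟩ τ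
    exact hrowsum _ s τ

theorem PhiLin_eq_convexHull [∀ j, Nonempty (A j)] : T.PhiLin = convexHull ℝ T.PhiLinPure := by
  refine Set.Subset.antisymm (fun f hf => ?_)
    (convexHull_min T.PhiLinPure_subset_PhiLin T.convex_PhiLin)
  obtain ⟨z, hz, rfl⟩ := T.exists_hyperflow_of_mem_PhiLin hf
  exact T.flowMap_mem_convexHull hz

end TreeFormDecisionProblem

theorem mainTheorem5 {J : Type u} {A : J → Type v} [Finite J] [∀ j, Finite (A j)]
    [∀ j, Nonempty (A j)] (T : TreeFormDecisionProblem J A) :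
    Set.extremePoints ℝ T.PhiLin = T.PhiLinPure ∧
      T.PhiLin = convexHull ℝ T.PhiLinPure := by
  have := Fintype.ofFinite J
  have := fun j => Fintype.ofFinite (A j)
  refine ⟨Set.Subset.antisymm ?_ T.PhiLinPure_subset_extremePoints, T.PhiLin_eq_convexHull⟩
  rw [T.PhiLin_eq_convexHull]
  exact extremePoints_convexHull_subset
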